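/- Let $0<\alpha<1$ and let $a,b,c\in\mathbb C$ with $ab\neq0$ and $c\neq0,-1,-2,\dots$. Put $f(z)=z\,{}_2F_1(a,b;c;z)$ for $|z|<1$, where ${}_2F_1(a,b;c;z)=\sum_{n\ge0}\frac{(a)_n(b)_n}{(c)_n\,n!}z^n$ is the Gaussian hypergeometric function. Suppose that (i) $p=a+b+1-c$ is a real number; (ii) $ab\neq p$ and $|\arg(ab-p)|<\pi\alpha/2$, where $\arg$ is the principal argument; (iii) for all $s\in(0,+\infty)$ and both signs $\varepsilon=\pm1$, $$G_\varepsilon(s^\alpha)\le\alpha\,(s+s^{-1})\,s^\alpha\,\Re\!\left[(ab-p)\,e^{\varepsilon\pi i(1-\alpha)/2}\right],$$ where $G_\varepsilon(x)=Sx^3+T_\varepsilon x^2+U_\varepsilon x+V$ with $$\begin{aligned} S&=2p\cos\tfrac{\pi\alpha}2,\\ T_\varepsilon&=|a|^2+|b|^2-|c-1|^2-2p-4p\cos^2\tfrac{\pi\alpha}2+4\,\Re[ae^{-\varepsilon i\pi\alpha/2}]\,\Re[be^{-\varepsilon i\pi\alpha/2}],\\ U_\varepsilon&=-2\left(|a|^2+|b|^2-|c-1|^2-3p\right)\cos\tfrac{\pi\alpha}2\\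 &\quad+2\,\Re[ae^{-\varepsilon i\pi\alpha/2}]\left(|b|^2-2\Re b\right)+2\,\Re[be^{-\varepsilon i\pi\alpha/2}]\left(|a|^2-2\Re a\right),\\ V&=|a|^2+|b|^2-|c-1|^2-2p+\left(|a|^2-2\Re a\right)\left(|b|^2-2\Re b\right). \end{aligned}$$ Then $f$ is strongly starlike of order $\alpha$; that is, $f$ is analytic on the unit disk $\mathbb D=\{z\in\mathbb C:|z|<1\}$ with $f(0)=0$ and $f'(0)=1$, and $\left|\arg\dfrac{zf'(z)}{f(z)}\right|<\dfrac{\pi\alpha}2$ for all $z\in\mathbb D$. (The quotient $zf'(z)/f(z)$ is read as $1$ at $z=0$; the claim includes that $f(z)\ne0$ and $f'(z)\neq0$ for $0<|z|<1$.) -/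

import Mathlib

noncomputable section

/-- `f` is strongly starlike of order `α`: `f` is analytic on the unit disk with `f 0 = 0` and
`f' 0 = 1`, and `|arg (z f'(z) / f(z))| < π α / 2` on the disk. The quotient `z f'(z) / f(z)` has
the value `1` at `z = 0` by continuity, so that only the points `z ≠ 0` impose a condition; there
the quotient has to be a finite nonzero number, so that its argument exists. -/
structure IsStronglyStarlike (α : ℝ) (f : ℂ → ℂ) : Prop where
  differentiableOn : DifferentiableOn ℂ f (Metric.ball 0 1)
  map_zero : f 0 = 0
  deriv_zero : deriv f 0 = 1
  ne_zero : ∀ z ∈ Metric.ball (0 : ℂ) 1, z ≠ 0 → f z ≠ 0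
  deriv_ne_zero : ∀ z ∈ Metric.ball (0 : ℂ) 1, z ≠ 0 → deriv f z ≠ 0
  abs_arg_lt : ∀ z ∈ Metric.ball (0 : ℂ) 1, z ≠ 0 →
    |Complex.arg (z * deriv f z / f z)| < Real.pi * α / 2

/-- The shifted Gaussian hypergeometric function `z ↦ z ₂F₁(a, b; c; z)`. -/
def shiftedHypergeometric (a b c : ℂ) (z : ℂ) : ℂ :=
  z * ordinaryHypergeometric a b c z

/-- `Re [u e^{-ε i π α / 2}]`. -/
def rotatedRe (α ε : ℝ) (u : ℂ) : ℝ :=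
  (u * Complex.exp (-(ε * Complex.I * Real.pi * α / 2))).re

/-- The coefficient of `x ^ 3`. -/
def coeffS (α p : ℝ) : ℝ :=
  2 * p * Real.cos (Real.pi * α / 2)

/-- The coefficient of `x ^ 2`. -/
def coeffT (α p ε : ℝ) (a b c : ℂ) : ℝ :=
  ‖a‖ ^ 2 + ‖b‖ ^ 2 - ‖c - 1‖ ^ 2 - 2 * p - 4 * p * Real.cos (Real.pi * α / 2) ^ 2
    + 4 * rotatedRe α ε a * rotatedRe α ε b

/-- The coefficient of `x`. -/
def coeffU (α p ε : ℝ) (a b c : ℂ) : ℝ :=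
  -2 * (‖a‖ ^ 2 + ‖b‖ ^ 2 - ‖c - 1‖ ^ 2 - 3 * p) * Real.cos (Real.pi * α / 2)
    + 2 * rotatedRe α ε a * (‖b‖ ^ 2 - 2 * b.re)
    + 2 * rotatedRe α ε b * (‖a‖ ^ 2 - 2 * a.re)

/-- The constant coefficient. -/
def coeffV (p : ℝ) (a b c : ℂ) : ℝ :=
  ‖a‖ ^ 2 + ‖b‖ ^ 2 - ‖c - 1‖ ^ 2 - 2 * p
    + (‖a‖ ^ 2 - 2 * a.re) * (‖b‖ ^ 2 - 2 * b.re)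

/-- The cubic `G_ε(x) = S x ^ 3 + T_ε x ^ 2 + U_ε x + V`. -/
def cubicG (α p ε : ℝ) (a b c : ℂ) (x : ℝ) : ℝ :=
  coeffS α p * x ^ 3 + coeffT α p ε a b c * x ^ 2 + coeffU α p ε a b c * x + coeffV p a b c

end

/-!
Write `f = z F`, `q = z f' / f` and suppose that `q` leaves the sector `|arg w| < π α / 2`, first at
`z₀`. Jack's lemma for the Cayley transform of `q ^ (1 / α)` gives, as in Nunokawa's lemma,
`q(z₀) = s ^ α e^{± i π α / 2}` and `z₀ q'(z₀) = ± i α k q(z₀)` with `k ≥ (s + 1 / s) / 2`. Gauss's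
hypergeometric equation is the Riccati equation `d + X = z (d + Y)` for `w = q - 1`, where
`d = z q'`, `X = w (w + c - 1)` and `Y = (w + a) (w + b)`. On the boundary rays of the sector
`|Y|² - |X|²` is the cubic `G_ε(s ^ α)`, and the hypothesis on `G_ε` becomes `|d + Y| ≤ |d + X|`.
Since `|z₀| < 1`, both sides vanish, which forces `Re [(a b - p) e^{ε π i (1 - α) / 2}] = 0` against
the hypothesis on `arg (a b - p)`. Nor can `q` cease to be defined first through a zero of `F`: as
long as `Re q ≥ 0`, the modulus `|f|` is nondecreasing along radii.
-/

open Metric Filter Topology Set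

section PowerSeries

variable {𝕜 E : Type*} [NontriviallyNormedField 𝕜] [NormedAddCommGroup E] [NormedSpace 𝕜 E]
  {f : 𝕜 → E} {p : FormalMultilinearSeries 𝕜 𝕜 E} {r : ENNReal}

theorem hasSum_coeff (h : HasFPowerSeriesOnBall f p 0 r) {z : 𝕜} (hz : z ∈ eball 0 r) :
    HasSum (fun n => z ^ n • p.coeff n) (f z) := by
  simpa only [FormalMultilinearSeries.apply_eq_pow_smul_coeff, zero_add] using h.hasSum hz

theorem hasFPowerSeriesOnBall_deriv [CompleteSpace E] {x : 𝕜} (h : HasFPowerSeriesOnBall f p x r) :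
    HasFPowerSeriesOnBall (deriv f)
      ((ContinuousLinearMap.apply 𝕜 E (1 : 𝕜)).compFormalMultilinearSeries p.derivSeries) x r :=
  (ContinuousLinearMap.apply 𝕜 E (1 : 𝕜)).comp_hasFPowerSeriesOnBall h.fderiv

theorem coeff_apply_one_derivSeries (p : FormalMultilinearSeries 𝕜 𝕜 E) (n : ℕ) :
    ((ContinuousLinearMap.apply 𝕜 E (1 : 𝕜)).compFormalMultilinearSeries p.derivSeries).coeff n =
      (n + 1) • p.coeff (n + 1) :=
  p.derivSeries_coeff_one n

end PowerSeries

/-! ### Gauss's hypergeometric equation -/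

section Hypergeometric

variable {𝕂 : Type*} [RCLike 𝕂] {a b c : 𝕂}

theorem ordinaryHypergeometricCoefficient_succ (hc : ∀ n : ℕ, c ≠ -(n : 𝕂)) (n : ℕ) :
    (n + 1) * (n + c) * ordinaryHypergeometricCoefficient a b c (n + 1) =
      (n + a) * (n + b) * ordinaryHypergeometricCoefficient a b c n := by
  have hn : (n + 1 : 𝕂) ≠ 0 := n.cast_add_one_ne_zero
  have hcn : c + n ≠ 0 := fun h => hc n (eq_neg_of_add_eq_zero_left h)
  simp only [ordinaryHypergeometricCoefficient, ascPochhammer_succ_eval, Nat.factorial_succ,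
    Nat.cast_mul, Nat.cast_succ, mul_inv]
  field_simp
  ring

theorem one_le_radius_ordinaryHypergeometricSeries (a b c : 𝕂) :
    1 ≤ (ordinaryHypergeometricSeries 𝕂 a b c).radius := by
  by_cases h : ∀ k : ℕ, (k : 𝕂) ≠ -a ∧ (k : 𝕂) ≠ -b ∧ (k : 𝕂) ≠ -c
  · exact (ordinaryHypergeometricSeries_radius_eq_one 𝕂 a b c h).ge
  · obtain ⟨k, hk⟩ : ∃ k : ℕ, (k : 𝕂) = -a ∨ (k : 𝕂) = -b ∨ (k : 𝕂) = -c := by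
      simpa only [not_forall, not_and_or, not_not] using h
    rw [(ordinaryHypergeometricSeries 𝕂 a b c).radius_eq_top_of_forall_image_add_eq_zero (k + 1)
      fun n => ordinaryHypergeometricSeries_eq_zero_of_neg_nat a b c hk (by lia)]
    exact le_top

theorem hasFPowerSeriesOnBall_ordinaryHypergeometric (a b c : 𝕂) :
    HasFPowerSeriesOnBall (ordinaryHypergeometric a b c)
      (ordinaryHypergeometricSeries 𝕂 a b c) 0 1 :=
  have h := one_le_radius_ordinaryHypergeometricSeries a b c
  ((ordinaryHypergeometricSeries 𝕂 a b c).hasFPowerSeriesOnBall (one_pos.trans_le h)).mono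
    one_pos h

theorem differentiableOn_ordinaryHypergeometric (a b c : 𝕂) :
    DifferentiableOn 𝕂 (ordinaryHypergeometric a b c : 𝕂 → 𝕂) (ball 0 1) :=
  (hasFPowerSeriesOnBall_ordinaryHypergeometric a b c).differentiableOn.mono fun z hz => by
    simpa [← ofReal_norm] using mem_ball_zero_iff.1 hz

theorem hasSum_mul_of_hasSum_succ {B : ℕ → 𝕂} {z S : 𝕂} (hB : B 0 = 0)
    (h : HasSum (fun n => z ^ n * B (n + 1)) S) : HasSum (fun n => z ^ n * B n) (z * S) := by
  rw [← hasSum_nat_add_iff' 1]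
  simpa [hB, pow_succ', mul_assoc] using h.mul_left z

theorem ordinaryHypergeometric_equation (a b : 𝕂) (hc : ∀ n : ℕ, c ≠ -(n : 𝕂)) {z : 𝕂}
    (hz : ‖z‖ < 1) :
    z * (1 - z) * deriv (deriv (ordinaryHypergeometric a b c)) z +
        (c - (a + b + 1) * z) * deriv (ordinaryHypergeometric a b c) z -
        a * b * ordinaryHypergeometric a b c z = 0 := by
  set F : 𝕂 → 𝕂 := ordinaryHypergeometric a b c
  set A := ordinaryHypergeometricCoefficient a b c
  have hz' : z ∈ eball (0 : 𝕂) 1 := by simpa [← ofReal_norm] using hz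
  have hF := hasFPowerSeriesOnBall_ordinaryHypergeometric a b c
  have hF' := hasFPowerSeriesOnBall_deriv hF
  have hA (n : ℕ) : (ordinaryHypergeometricSeries 𝕂 a b c).coeff n = A n :=
    FormalMultilinearSeries.coeff_ofScalars
  have h₀ : HasSum (fun n => z ^ n * A n) (F z) := by
    simpa only [hA, smul_eq_mul] using hasSum_coeff hF hz'
  have h₁ : HasSum (fun n => z ^ n * ((n + 1) * A (n + 1))) (deriv F z) := by
    simpa [coeff_apply_one_derivSeries, hA] using hasSum_coeff hF' hz'
  have h₂ : HasSum (fun n => z ^ n * ((n + 1) * ((n + 2) * A (n + 2)))) (deriv (deriv F) z) := by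
    simpa [coeff_apply_one_derivSeries, hA, add_assoc, one_add_one_eq_two] using
      hasSum_coeff (hasFPowerSeriesOnBall_deriv hF') hz'
  have hzF' := hasSum_mul_of_hasSum_succ (B := fun n => n * A n) (by simp) (by simpa using h₁)
  have hzF'' := hasSum_mul_of_hasSum_succ (B := fun n => n * ((n + 1) * A (n + 1))) (by simp)
    (by simpa [add_assoc, one_add_one_eq_two] using h₂)
  have hzzF'' := hasSum_mul_of_hasSum_succ (B := fun n => (n - 1) * (n * A n)) (by simp)
    (by simpa using hzF'')
  have hl := hzF''.add (h₁.mul_left c)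
  have hr := (hzzF''.add (hzF'.mul_left (a + b + 1))).add (h₀.mul_left (a * b))
  have : z * deriv (deriv F) z + c * deriv F z = _ := hl.unique (hr.congr_fun fun n => by
    linear_combination z ^ n * ordinaryHypergeometricCoefficient_succ (a := a) (b := b) hc n)
  linear_combination this

end Hypergeometric

/-! ### Jack's lemma -/

section BoundaryPoint

variable {z₀ : ℂ}

theorem norm_le_re_of_forall_re_mul_le {v : ℂ} (h : ∀ w ∈ ball (0 : ℂ) 1, (v * w).re ≤ v.re) :
    ‖v‖ ≤ v.re := by
  have hclosed : IsClosed {w : ℂ | (v * w).re ≤ v.re} :=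
    isClosed_le (by fun_prop) continuous_const
  have hmem : starRingEnd ℂ v / ‖v‖ ∈ closure (ball (0 : ℂ) 1) := by
    simpa [closure_ball] using div_self_le_one ‖v‖
  have hle : (v * (starRingEnd ℂ v / ‖v‖)).re ≤ v.re := closure_minimal h hclosed hmem
  rwa [← mul_div_assoc, Complex.mul_conj, Complex.normSq_eq_norm_sq, ← Complex.ofReal_div,
    Complex.ofReal_re, sq, mul_self_div_self] at hle

theorem exists_nonneg_mul_deriv_eq_of_norm_le {g : ℂ → ℂ} (hd : DifferentiableAt ℂ g z₀)
    (hne : g z₀ ≠ 0) (hmax : ∀ z ∈ ball 0 ‖z₀‖, ‖g z‖ ≤ ‖g z₀‖) :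
    ∃ m : ℝ, 0 ≤ m ∧ z₀ * deriv g z₀ = m * g z₀ := by
  obtain rfl | hz₀ := eq_or_ne z₀ 0
  · exact ⟨0, le_rfl, by simp⟩
  set v : ℂ := z₀ * deriv g z₀ / g z₀ with hv
  have hinward (w : ℂ) (hw : w ∈ ball (0 : ℂ) 1) : (v * w).re ≤ v.re := by
    have hmem : w * z₀ ∈ ball 0 ‖z₀‖ := by
      simpa using mul_lt_of_lt_one_left (norm_pos_iff.2 hz₀) (mem_ball_zero_iff.1 hw)
    have hsegment : openSegment ℝ z₀ (w * z₀) ⊆ ball 0 ‖z₀‖ := by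
      have hclosure : z₀ ∈ closure (ball 0 ‖z₀‖) := by
        simp [closure_ball _ (norm_ne_zero_iff.2 hz₀)]
      simpa only [isOpen_ball.interior_eq] using (convex_ball (0 : ℂ) ‖z₀‖)
        |>.openSegment_closure_interior_subset_interior hclosure (isOpen_ball.interior_eq.ge hmem)
    have hmaxOn : IsMaxOn (fun z => ‖g z‖ ^ 2) (ball 0 ‖z₀‖) z₀ := fun z hz =>
      pow_le_pow_left₀ (norm_nonneg _) (hmax z hz) 2
    have hle := hmaxOn.localize.hasFDerivWithinAt_nonpos
      (hd.hasDerivAt.hasFDerivAt.restrictScalars ℝ).norm_sq.hasFDerivWithinAt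
      (sub_mem_posTangentConeAt_of_openSegment_subset hsegment)
    have hinner : inner ℝ (g z₀) ((w * z₀ - z₀) * deriv g z₀) =
        ‖g z₀‖ ^ 2 * ((v * w).re - v.re) := by
      rw [Complex.inner, ← Complex.sub_re, ← Complex.re_ofReal_mul, Complex.sq_norm,
        ← Complex.mul_conj, hv]
      congr 1
      field_simp
    change 2 • inner ℝ (g z₀) ((w * z₀ - z₀) * deriv g z₀) ≤ 0 at hle
    rw [hinner, nsmul_nonpos_iff two_ne_zero] at hle
    have := nonpos_of_mul_nonpos_right hle (by positivity)
    linarith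
  have hnorm : ‖v‖ ≤ v.re := norm_le_re_of_forall_re_mul_le hinward
  refine ⟨v.re, (norm_nonneg v).trans hnorm, ?_⟩
  have hreal : v.im = 0 := Complex.abs_re_eq_norm.1 <|
    (Complex.abs_re_le_norm v).antisymm (hnorm.trans (le_abs_self _))
  rw [← div_eq_iff hne]
  exact Complex.ext rfl hreal

theorem jack_lemma {φ : ℂ → ℂ} (hφ : DifferentiableOn ℂ φ (ball 0 ‖z₀‖))
    (hd : DifferentiableAt ℂ φ z₀) (h0 : φ 0 = 0) (hne : φ z₀ ≠ 0)
    (hmax : ∀ z ∈ ball 0 ‖z₀‖, ‖φ z‖ ≤ ‖φ z₀‖) :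
    ∃ m : ℝ, 1 ≤ m ∧ z₀ * deriv φ z₀ = m * φ z₀ := by
  have hz₀ : z₀ ≠ 0 := by rintro rfl; exact hne h0
  have hslope : dslope φ 0 z₀ = φ z₀ / z₀ := by
    rw [dslope_of_ne _ hz₀, slope_def_field, h0, sub_zero, sub_zero]
  have hderiv : HasDerivAt (dslope φ 0) (deriv φ z₀ / z₀ - φ z₀ / z₀ ^ 2) z₀ := by
    have hdiv : HasDerivAt (fun z => φ z / z) (deriv φ z₀ / z₀ - φ z₀ / z₀ ^ 2) z₀ := by
      convert! hd.hasDerivAt.fun_div (hasDerivAt_id z₀) hz₀ using 1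
      simp only [id]
      field_simp
    refine hdiv.congr_of_eventuallyEq ?_
    filter_upwards [eventually_ne_nhds hz₀] with z hz
    rw [dslope_of_ne _ hz, slope_def_field, h0, sub_zero, sub_zero]
  obtain ⟨m, hm, heq⟩ := exists_nonneg_mul_deriv_eq_of_norm_le hderiv.differentiableAt
    (hslope ▸ div_ne_zero hne hz₀) fun z hz => by
      have hmaps : MapsTo φ (ball 0 ‖z₀‖) (closedBall (φ 0) ‖φ z₀‖) := fun y hy => by
        simpa [h0] using hmax y hy
      simpa [hslope] using Complex.norm_dslope_le_div_of_mapsTo_ball hφ hmaps hz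
  refine ⟨m + 1, by linarith, ?_⟩
  rw [hderiv.deriv, hslope] at heq
  field_simp at heq
  push_cast
  linear_combination heq

theorem norm_one_add_sq_sub_norm_one_sub_sq (w : ℂ) : ‖1 + w‖ ^ 2 - ‖1 - w‖ ^ 2 = 4 * w.re := by
  simp only [Complex.sq_norm, Complex.normSq_add, Complex.normSq_sub, map_one, one_mul,
    Complex.conj_re]
  ring

theorem exists_mul_deriv_eq_neg_of_re_eq_zero {P : ℂ → ℂ}
    (hP : DifferentiableOn ℂ P (ball 0 ‖z₀‖)) (hd : DifferentiableAt ℂ P z₀) (h0 : P 0 = 1)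
    (hpos : ∀ z ∈ ball 0 ‖z₀‖, 0 < (P z).re) (hzero : (P z₀).re = 0) :
    ∃ m : ℝ, (1 + ‖P z₀‖ ^ 2) / 2 ≤ m ∧ z₀ * deriv P z₀ = -m := by
  have hne {z : ℂ} (hz : 0 ≤ (P z).re) : 1 + P z ≠ 0 := fun h => by
    have := congrArg Complex.re h
    simp only [Complex.add_re, Complex.one_re, Complex.zero_re] at this
    linarith
  have hle {z : ℂ} (hz : 0 ≤ (P z).re) : ‖(1 - P z) / (1 + P z)‖ ≤ 1 := by
    rw [norm_div, div_le_one (norm_pos_iff.2 (hne hz)), ← sq_le_sq₀ (norm_nonneg _) (norm_nonneg _)]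
    linarith [norm_one_add_sq_sub_norm_one_sub_sq (P z)]
  have hnorm : ‖(1 - P z₀) / (1 + P z₀)‖ = 1 := by
    rw [norm_div, div_eq_one_iff_eq (norm_ne_zero_iff.2 (hne hzero.ge)),
      ← sq_eq_sq₀ (norm_nonneg _) (norm_nonneg _)]
    linarith [norm_one_add_sq_sub_norm_one_sub_sq (P z₀)]
  have hderiv := (hd.hasDerivAt.const_sub 1).fun_div (hd.hasDerivAt.const_add 1) (hne hzero.ge)
  obtain ⟨m, hm, heq⟩ := jack_lemma (φ := fun z => (1 - P z) / (1 + P z))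
    ((hP.const_sub 1).div (hP.const_add 1) fun z hz => hne (hpos z hz).le)
    hderiv.differentiableAt (by simp [h0]) (norm_ne_zero_iff.1 (hnorm ▸ one_ne_zero))
    fun z hz => (hle (hpos z hz).le).trans hnorm.ge
  have hsq : P z₀ ^ 2 = -(‖P z₀‖ ^ 2 : ℝ) := by
    rw [Complex.sq_norm, Complex.normSq_apply, hzero]
    apply Complex.ext <;> simp [sq, hzero]
  refine ⟨m * ((1 + ‖P z₀‖ ^ 2) / 2), le_mul_of_one_le_left (by positivity) hm, ?_⟩
  rw [hderiv.deriv] at heq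
  have := hne hzero.ge
  field_simp at heq
  push_cast at hsq ⊢
  linear_combination (-1 / 2 : ℂ) * heq + m / 2 * hsq

end BoundaryPoint

/-! ### Nunokawa's lemma -/

theorem hasDerivAt_cpow_ofReal_zero {r : ℝ} (hr : 1 < r) :
    HasDerivAt (fun w : ℂ => w ^ (r : ℂ)) 0 0 := by
  have hr0 : (r : ℂ) ≠ 0 := by exact_mod_cast (one_pos.trans hr).ne'
  have hlim : Tendsto (fun w : ℂ => ‖w‖ ^ (r - 1)) (𝓝 0) (𝓝 0) := by
    simpa [Real.zero_rpow (sub_ne_zero.2 hr.ne')] using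
      (continuous_norm (E := ℂ)).tendsto 0 |>.rpow_const (p := r - 1) (Or.inr (by linarith))
  rw [hasDerivAt_iff_tendsto_slope_zero, tendsto_zero_iff_norm_tendsto_zero]
  refine (hlim.mono_left nhdsWithin_le_nhds).congr' ?_
  filter_upwards [self_mem_nhdsWithin] with w hw
  rw [zero_add, Complex.zero_cpow hr0, sub_zero, smul_eq_mul, norm_mul, norm_inv,
    Complex.norm_cpow_real, Real.rpow_sub_one (norm_ne_zero_iff.2 hw), div_eq_inv_mul]

/-- The sector `|arg w| < β`, for `0 ≤ β ≤ π`. Comparing cosines makes it visibly open, although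
`Complex.arg` jumps on the negative real axis, and excludes the junk value `arg 0 = 0`. -/
def openSector (β : ℝ) : Set ℂ :=
  {w | ‖w‖ * Real.cos β < w.re}

section Sector

variable {β : ℝ} {w : ℂ}

theorem isOpen_openSector (β : ℝ) : IsOpen (openSector β) :=
  isOpen_lt (by fun_prop) Complex.continuous_re

theorem ne_zero_of_mem_openSector (hw : w ∈ openSector β) : w ≠ 0 := by
  rintro rfl
  simp [openSector] at hw

theorem mem_openSector_iff_abs_arg_lt (hβ : β ∈ Icc 0 Real.pi) (hw : w ≠ 0) :
    w ∈ openSector β ↔ |w.arg| < β := by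
  rw [openSector, mem_ofPred_eq, ← Complex.norm_mul_cos_arg w,
    mul_lt_mul_iff_right₀ (norm_pos_iff.2 hw), ← Real.cos_abs w.arg]
  exact Real.strictAntiOn_cos.lt_iff_gt hβ ⟨abs_nonneg _, Complex.abs_arg_le_pi w⟩

theorem one_mem_openSector (hβ : β ∈ Ioc 0 Real.pi) : (1 : ℂ) ∈ openSector β := by
  rw [mem_openSector_iff_abs_arg_lt (Ioc_subset_Icc_self hβ) one_ne_zero]
  simpa using hβ.1

theorem abs_arg_eq_of_mem_frontier_openSector (hβ : β ∈ Icc 0 Real.pi) (hw0 : w ≠ 0)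
    (hw : w ∈ frontier (openSector β)) : |w.arg| = β := by
  have heq : ‖w‖ * Real.cos β = w.re :=
    frontier_lt_subset_eq (by fun_prop) Complex.continuous_re hw
  rw [← Complex.norm_mul_cos_arg w, mul_right_inj' (norm_ne_zero_iff.2 hw0),
    ← Real.cos_abs w.arg] at heq
  exact (Real.injOn_cos hβ ⟨abs_nonneg _, Complex.abs_arg_le_pi w⟩ heq).symm

theorem re_nonneg_of_mem_openSector (hβ : β ∈ Icc 0 (Real.pi / 2)) (hw : w ∈ openSector β) :
    0 ≤ w.re :=
  (mul_nonneg (norm_nonneg w)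
    (Real.cos_nonneg_of_mem_Icc ⟨by linarith [hβ.1, Real.pi_pos], hβ.2⟩)).trans (le_of_lt hw)

theorem re_cpow_inv_pos_of_mem_openSector {α : ℝ} (hα : α ∈ Ioc 0 2)
    (hw : w ∈ openSector (Real.pi * α / 2)) : 0 < (w ^ ((α⁻¹ : ℝ) : ℂ)).re := by
  have hπ := Real.pi_pos
  have hw0 := ne_zero_of_mem_openSector hw
  have hlt : |w.arg * α⁻¹| < Real.pi / 2 := by
    rw [mem_openSector_iff_abs_arg_lt ⟨by nlinarith [hα.1], by nlinarith [hα.2]⟩ hw0] at hw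
    rw [← div_eq_mul_inv, abs_div, abs_of_pos hα.1, div_lt_iff₀ hα.1]
    linarith
  rw [Complex.cpow_ofReal_re]
  exact mul_pos (Real.rpow_pos_of_pos (norm_pos_iff.2 hw0) _)
    (Real.cos_pos_of_mem_Ioo (abs_lt.1 hlt))

theorem re_cpow_inv_eq_zero_of_abs_arg_eq {α : ℝ} (hα : α ≠ 0)
    (hw : |w.arg| = Real.pi * α / 2) : (w ^ ((α⁻¹ : ℝ) : ℂ)).re = 0 := by
  have hangle : Real.pi * α / 2 * α⁻¹ = Real.pi / 2 := by field_simp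
  rw [Complex.cpow_ofReal_re]
  rcases eq_or_eq_neg_of_abs_eq hw with h | h
  · rw [h, hangle, Real.cos_pi_div_two, mul_zero]
  · rw [h, neg_mul, hangle, Real.cos_neg, Real.cos_pi_div_two, mul_zero]

theorem openSector_subset_slitPlane (hβ : β ∈ Icc 0 Real.pi) :
    openSector β ⊆ Complex.slitPlane := fun w hw => by
  have hw0 := ne_zero_of_mem_openSector hw
  have harg := ((mem_openSector_iff_abs_arg_lt hβ hw0).1 hw).trans_le hβ.2
  exact Complex.mem_slitPlane_iff_arg.2 ⟨((abs_lt.1 harg).2).ne, hw0⟩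

/-- The unit vector `e^{ε i π α / 2}` spanning, for `ε = ±1`, one of the two boundary rays of
`openSector (π α / 2)`. -/
noncomputable def sectorRay (α ε : ℝ) : ℂ :=
  Complex.exp ((ε * (Real.pi * α / 2) : ℝ) * Complex.I)

/-- The pairs `(q z₀, z₀ q'(z₀))` which Nunokawa's lemma allows at a point `z₀` where `q` first
leaves `openSector (π α / 2)`; here `‖q z₀‖ = s ^ α`, and `ε` tells which boundary ray is hit. -/
def IsSectorExit (α : ℝ) (w d : ℂ) : Prop :=
  ∃ ε s k : ℝ, (ε = 1 ∨ ε = -1) ∧ 0 < s ∧ (s + s⁻¹) / 2 ≤ k ∧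
    w = (s ^ α : ℝ) * sectorRay α ε ∧ d = (ε * α * k : ℝ) * Complex.I * w

theorem cpow_inv_eq_of_arg_eq {α ε : ℝ} (hα : α ≠ 0) (hε : ε = 1 ∨ ε = -1)
    (harg : w.arg = ε * (Real.pi * α / 2)) :
    w ^ ((α⁻¹ : ℝ) : ℂ) = (‖w‖ ^ α⁻¹ : ℝ) * (ε * Complex.I) := by
  have hangle : w.arg * α⁻¹ = ε * (Real.pi / 2) := by rw [harg]; field_simp
  apply Complex.ext
  · rw [Complex.cpow_ofReal_re, hangle]
    rcases hε with rfl | rfl <;> simp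
  · rw [Complex.cpow_ofReal_im, hangle]
    rcases hε with rfl | rfl <;> simp

theorem isSectorExit_of_mul_deriv_cpow_eq {q : ℂ → ℂ} {z₀ : ℂ} {α m : ℝ} (hα : 0 < α)
    (hd : DifferentiableAt ℂ q z₀) (hslit : q z₀ ∈ Complex.slitPlane)
    (harg : |(q z₀).arg| = Real.pi * α / 2)
    (hm : (1 + ‖q z₀ ^ ((α⁻¹ : ℝ) : ℂ)‖ ^ 2) / 2 ≤ m)
    (heq : z₀ * deriv (fun z => q z ^ ((α⁻¹ : ℝ) : ℂ)) z₀ = -m) :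
    IsSectorExit α (q z₀) (z₀ * deriv q z₀) := by
  have hq : q z₀ ≠ 0 := Complex.slitPlane_ne_zero hslit
  obtain ⟨ε, hε, harg⟩ : ∃ ε : ℝ, (ε = 1 ∨ ε = -1) ∧ (q z₀).arg = ε * (Real.pi * α / 2) := by
    rcases eq_or_eq_neg_of_abs_eq harg with h | h
    · exact ⟨1, .inl rfl, by rw [h, one_mul]⟩
    · exact ⟨-1, .inr rfl, by rw [h, neg_one_mul]⟩
  have hroot := cpow_inv_eq_of_arg_eq hα.ne' hε harg
  set s : ℝ := ‖q z₀‖ ^ α⁻¹ with hs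
  have hs0 : 0 < s := Real.rpow_pos_of_pos (norm_pos_iff.2 hq) _
  have hpolar : q z₀ = (s ^ α : ℝ) * sectorRay α ε := by
    rw [hs, Real.rpow_inv_rpow (norm_nonneg _) hα.ne', sectorRay, ← harg,
      Complex.norm_mul_exp_arg_mul_I]
  have hαC : (α : ℂ) ≠ 0 := by exact_mod_cast hα.ne'
  have hsC : (s : ℂ) ≠ 0 := by exact_mod_cast hs0.ne'
  have hεε : (ε : ℂ) ^ 2 = 1 := by rcases hε with rfl | rfl <;> simp
  refine ⟨ε, s, m / s, hε, hs0, ?_, hpolar, ?_⟩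
  · rw [Complex.norm_cpow_real, ← hs] at hm
    rw [le_div_iff₀ hs0]
    refine Eq.trans_le ?_ hm
    field_simp
    ring
  · rw [(hd.hasDerivAt.cpow_const hslit).deriv, Complex.cpow_sub _ _ hq, Complex.cpow_one, hroot]
      at heq
    push_cast at heq ⊢
    field_simp at heq ⊢
    linear_combination (-ε * Complex.I) * heq +
      s * z₀ * deriv q z₀ * (Complex.I ^ 2 * hεε + Complex.I_sq)

theorem exists_mul_deriv_cpow_inv_eq_neg {q : ℂ → ℂ} {z₀ : ℂ} {α : ℝ} (hα : α ∈ Ioc 0 2)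
    (hq : DifferentiableOn ℂ q (ball 0 ‖z₀‖)) (h0 : q 0 = 1)
    (hmaps : MapsTo q (ball 0 ‖z₀‖) (openSector (Real.pi * α / 2)))
    (hd : DifferentiableAt ℂ (fun z => q z ^ ((α⁻¹ : ℝ) : ℂ)) z₀)
    (hzero : (q z₀ ^ ((α⁻¹ : ℝ) : ℂ)).re = 0) :
    ∃ m : ℝ, (1 + ‖q z₀ ^ ((α⁻¹ : ℝ) : ℂ)‖ ^ 2) / 2 ≤ m ∧
      z₀ * deriv (fun z => q z ^ ((α⁻¹ : ℝ) : ℂ)) z₀ = -m := by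
  have hβ : Real.pi * α / 2 ∈ Icc 0 Real.pi :=
    ⟨by have := hα.1; positivity, by nlinarith [hα.2, Real.pi_pos]⟩
  refine exists_mul_deriv_eq_neg_of_re_eq_zero (P := fun z => q z ^ ((α⁻¹ : ℝ) : ℂ)) ?_ hd
    (by simp [h0]) (fun z hz => re_cpow_inv_pos_of_mem_openSector hα (hmaps hz)) hzero
  exact hq.cpow (differentiableOn_const _) fun z hz => openSector_subset_slitPlane hβ (hmaps hz)

-- Since `α⁻¹ > 1`, a zero `z₀` of `q` would be a critical point of `q ^ α⁻¹`, whereas `z₀` times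
-- the derivative of `q ^ α⁻¹` at `z₀` is at most `-1 / 2`.
theorem ne_zero_of_mapsTo_openSector {q : ℂ → ℂ} {z₀ : ℂ} {α : ℝ} (hα : α ∈ Ioo 0 1)
    (hq : DifferentiableOn ℂ q (ball 0 ‖z₀‖)) (hd : DifferentiableAt ℂ q z₀)
    (h0 : q 0 = 1) (hmaps : MapsTo q (ball 0 ‖z₀‖) (openSector (Real.pi * α / 2))) :
    q z₀ ≠ 0 := fun hq0 => by
  have hroot0 : q z₀ ^ ((α⁻¹ : ℝ) : ℂ) = 0 := by simp [hq0, hα.1.ne']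
  have hderiv : HasDerivAt (fun z => q z ^ ((α⁻¹ : ℝ) : ℂ)) 0 z₀ := by
    have := (hasDerivAt_cpow_ofReal_zero (one_lt_inv_iff₀.2 hα)).comp_of_eq z₀ hd.hasDerivAt
      hq0.symm
    rwa [zero_mul] at this
  obtain ⟨m, hm, heq⟩ := exists_mul_deriv_cpow_inv_eq_neg ⟨hα.1, by linarith [hα.2]⟩ hq h0 hmaps
    hderiv.differentiableAt (by rw [hroot0, Complex.zero_re])
  have hm0 : m = 0 := by
    rw [hderiv.deriv] at heq
    simpa using heq
  rw [hm0, hroot0] at hm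
  norm_num at hm

theorem isSectorExit_of_notMem_openSector {q : ℂ → ℂ} {z₀ : ℂ} {α : ℝ} (hα : α ∈ Ioo 0 1)
    (hq : DifferentiableOn ℂ q (ball 0 ‖z₀‖)) (hd : DifferentiableAt ℂ q z₀) (h0 : q 0 = 1)
    (hmaps : MapsTo q (ball 0 ‖z₀‖) (openSector (Real.pi * α / 2)))
    (hexit : q z₀ ∉ openSector (Real.pi * α / 2)) :
    IsSectorExit α (q z₀) (z₀ * deriv q z₀) := by
  have hπ := Real.pi_pos
  have hβ : Real.pi * α / 2 ∈ Ioc 0 Real.pi := ⟨by nlinarith [hα.1], by nlinarith [hα.2]⟩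
  have hz₀ : z₀ ≠ 0 := fun h => hexit <| by
    rw [h, h0]
    exact one_mem_openSector hβ
  have hq0 := ne_zero_of_mapsTo_openSector hα hq hd h0 hmaps
  have hfrontier : q z₀ ∈ frontier (openSector (Real.pi * α / 2)) := by
    have hclosure : z₀ ∈ closure (ball 0 ‖z₀‖) := by
      simp [closure_ball _ (norm_ne_zero_iff.2 hz₀)]
    rw [(isOpen_openSector _).frontier_eq]
    exact ⟨hd.continuousAt.continuousWithinAt.mem_closure hclosure hmaps, hexit⟩
  have harg := abs_arg_eq_of_mem_frontier_openSector (Ioc_subset_Icc_self hβ) hq0 hfrontier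
  have hslit : q z₀ ∈ Complex.slitPlane :=
    Complex.mem_slitPlane_iff_arg.2 ⟨fun h => by
      rw [h, abs_of_pos hπ] at harg
      nlinarith [hα.2], hq0⟩
  obtain ⟨m, hm, heq⟩ := exists_mul_deriv_cpow_inv_eq_neg ⟨hα.1, by linarith [hα.2]⟩ hq h0 hmaps
    (hd.hasDerivAt.cpow_const hslit).differentiableAt
    (re_cpow_inv_eq_zero_of_abs_arg_eq hα.1.ne' harg)
  exact isSectorExit_of_mul_deriv_cpow_eq hα.1 hd hslit harg hm heq

end Sector

/-! ### Strong starlikeness -/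

theorem monotoneOn_norm_of_inner_deriv_nonneg {E : Type*} [NormedAddCommGroup E]
    [InnerProductSpace ℝ E] {D : Set ℝ} (hD : Convex ℝ D) {f f' : ℝ → E}
    (hf : ContinuousOn f D) (hf' : ∀ t ∈ interior D, HasDerivAt f (f' t) t)
    (h : ∀ t ∈ interior D, 0 ≤ inner ℝ (f t) (f' t)) : MonotoneOn (fun t => ‖f t‖) D := by
  have hsq : MonotoneOn (fun t => ‖f t‖ ^ 2) D :=
    monotoneOn_of_hasDerivWithinAt_nonneg hD (hf.norm.pow 2)
      (fun t ht => (hf' t ht).norm_sq.hasDerivWithinAt)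
      fun t ht => mul_nonneg zero_le_two (h t ht)
  exact fun x hx y hy hxy => le_of_sq_le_sq (hsq hx hy hxy) (norm_nonneg _)

theorem inner_mul_deriv (f : ℂ → ℂ) (z : ℂ) :
    inner ℝ (f z) (z * deriv f z) = ‖f z‖ ^ 2 * (z * logDeriv f z).re := by
  rw [Complex.inner, ← Complex.re_ofReal_mul, Complex.sq_norm, ← Complex.mul_conj, logDeriv_apply]
  congr 1
  by_cases h : f z = 0
  · simp [h]
  · field_simp

theorem monotoneOn_norm_radius_of_re_logDeriv_nonneg {f : ℂ → ℂ} {z₀ : ℂ} (hz₀ : z₀ ≠ 0)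
    (hf : DifferentiableOn ℂ f (ball 0 ‖z₀‖)) (hc : ContinuousAt f z₀)
    (hre : ∀ z ∈ ball 0 ‖z₀‖, 0 ≤ (z * logDeriv f z).re) :
    MonotoneOn (fun t : ℝ => ‖f (t * z₀)‖) (Ioc 0 1) := by
  have hmem {t : ℝ} (ht : t ∈ Ioo 0 1) : t * z₀ ∈ ball 0 ‖z₀‖ := by
    rw [mem_ball_zero_iff, norm_mul, Complex.norm_of_nonneg ht.1.le]
    exact mul_lt_of_lt_one_left (norm_pos_iff.2 hz₀) ht.2
  have hderiv {t : ℝ} (ht : t ∈ Ioo 0 1) :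
      HasDerivAt (fun t : ℝ => f (t * z₀)) (deriv f (t * z₀) * z₀) t := by
    have hline : HasDerivAt (fun t : ℝ => (t : ℂ) * z₀) z₀ t := by
      simpa using (Complex.ofRealCLM.hasDerivAt (x := t)).mul_const z₀
    have hft := hf.differentiableAt (isOpen_ball.mem_nhds (hmem ht))
    exact HasDerivAt.comp t hft.hasDerivAt hline
  have hinner {t : ℝ} (ht : t ∈ Ioo 0 1) : 0 ≤ inner ℝ (f (t * z₀)) (deriv f (t * z₀) * z₀) := by
    have ht0 : (t : ℂ) ≠ 0 := by exact_mod_cast ht.1.ne'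
    have hsmul : deriv f (t * z₀) * z₀ = t⁻¹ • (t * z₀ * deriv f (t * z₀)) := by
      rw [Complex.real_smul]
      push_cast
      field_simp
    rw [hsmul, real_inner_smul_right, inner_mul_deriv]
    exact mul_nonneg (inv_nonneg.2 ht.1.le) (mul_nonneg (sq_nonneg _) (hre _ (hmem ht)))
  refine monotoneOn_norm_of_inner_deriv_nonneg (convex_Ioc 0 1) (fun t ht => ?_)
    (fun t ht => hderiv (interior_Ioc.le ht)) fun t ht => hinner (interior_Ioc.le ht)
  refine ContinuousAt.continuousWithinAt ?_
  obtain rfl | ht1 := ht.2.eq_or_lt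
  · exact ContinuousAt.comp (f := fun t : ℝ => (t : ℂ) * z₀) (by simpa using hc) (by fun_prop)
  · exact (hderiv ⟨ht.1, ht1⟩).continuousAt

theorem ne_zero_of_re_logDeriv_nonneg {f : ℂ → ℂ} {z₀ : ℂ} (hz₀ : z₀ ≠ 0)
    (hf : DifferentiableOn ℂ f (ball 0 ‖z₀‖)) (hc : ContinuousAt f z₀)
    (hne : ∀ z ∈ ball 0 ‖z₀‖, z ≠ 0 → f z ≠ 0)
    (hre : ∀ z ∈ ball 0 ‖z₀‖, 0 ≤ (z * logDeriv f z).re) : f z₀ ≠ 0 := by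
  have hle : ‖f ((1 / 2 : ℝ) * z₀)‖ ≤ ‖f ((1 : ℝ) * z₀)‖ :=
    monotoneOn_norm_radius_of_re_logDeriv_nonneg hz₀ hf hc hre ⟨by norm_num, by norm_num⟩
      ⟨one_pos, le_rfl⟩ (by norm_num)
  have hhalf : f ((1 / 2 : ℝ) * z₀) ≠ 0 := by
    refine hne _ ?_ (mul_ne_zero (by norm_num) hz₀)
    rw [mem_ball_zero_iff, norm_mul, Complex.norm_of_nonneg (by norm_num)]
    linarith [norm_pos_iff.2 hz₀]
  rw [Complex.ofReal_one, one_mul] at hle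
  exact norm_pos_iff.1 ((norm_pos_iff.2 hhalf).trans_le hle)

/-- `z f'(z) / f(z)` for `f(z) = z F(z)`, with the value `1` at `z = 0`. Where `F` vanishes, so that
`logDeriv F` is the junk value `0`, it has no meaning. -/
noncomputable def starQuotient {𝕜 : Type*} [NontriviallyNormedField 𝕜] (F : 𝕜 → 𝕜) (z : 𝕜) : 𝕜 :=
  1 + z * logDeriv F z

theorem hasDerivAt_starQuotient {𝕜 : Type*} [NontriviallyNormedField 𝕜] [CompleteSpace 𝕜]
    {F : 𝕜 → 𝕜} {z : 𝕜} (hF : AnalyticAt 𝕜 F z) (hne : F z ≠ 0) :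
    HasDerivAt (starQuotient F)
      (logDeriv F z + z * (deriv (deriv F) z / F z - logDeriv F z ^ 2)) z := by
  have hquot := hF.deriv.differentiableAt.hasDerivAt.div hF.differentiableAt.hasDerivAt hne
  refine (((hasDerivAt_id z).mul hquot).const_add 1).congr_deriv ?_
  simp only [logDeriv_apply, id, Pi.div_apply]
  field_simp

theorem isOpen_setOf_starQuotient_mem {𝕜 : Type*} [NontriviallyNormedField 𝕜] [CompleteSpace 𝕜]
    {F : 𝕜 → 𝕜} {D V : Set 𝕜} (hD : IsOpen D) (hF : AnalyticOnNhd 𝕜 F D) (hV : IsOpen V) :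
    IsOpen {z | z ∈ D ∧ F z ≠ 0 ∧ starQuotient F z ∈ V} := by
  refine isOpen_iff_mem_nhds.2 fun z ⟨hz, hne, hmem⟩ => ?_
  filter_upwards [hD.mem_nhds hz, (hF z hz).continuousAt.eventually_ne hne,
    (hasDerivAt_starQuotient (hF z hz) hne).continuousAt.eventually_mem (hV.mem_nhds hmem)]
    with y hy hyne hymem using ⟨hy, hyne, hymem⟩

theorem mul_logDeriv_id_mul {𝕜 : Type*} [NontriviallyNormedField 𝕜] {F : 𝕜 → 𝕜} {z : 𝕜}
    (hz : z ≠ 0) (hF : DifferentiableAt 𝕜 F z) (hne : F z ≠ 0) :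
    z * logDeriv (fun z => z * F z) z = starQuotient F z := by
  rw [logDeriv_mul (f := fun z => z) z hz hne differentiableAt_fun_id hF, logDeriv_id',
    starQuotient, mul_add, mul_one_div_cancel hz]

theorem ne_zero_of_re_starQuotient_nonneg {F : ℂ → ℂ} {z₀ : ℂ} (hz₀ : z₀ ≠ 0)
    (hF : DifferentiableOn ℂ F (ball 0 ‖z₀‖)) (hc : ContinuousAt F z₀)
    (hne : ∀ z ∈ ball 0 ‖z₀‖, F z ≠ 0)
    (hre : ∀ z ∈ ball 0 ‖z₀‖, 0 ≤ (starQuotient F z).re) : F z₀ ≠ 0 := by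
  refine right_ne_zero_of_mul <| ne_zero_of_re_logDeriv_nonneg (f := fun z => z * F z) hz₀
    (differentiableOn_id.mul hF) (continuousAt_id.mul hc)
    (fun z hz hz0 => mul_ne_zero hz0 (hne z hz)) fun z hz => ?_
  obtain rfl | hz0 := eq_or_ne z 0
  · simp
  · rw [mul_logDeriv_id_mul hz0 (hF.differentiableAt (isOpen_ball.mem_nhds hz)) (hne z hz)]
    exact hre z hz

theorem exists_notMem_ball_norm_subset {E : Type*} [SeminormedAddCommGroup E] [ProperSpace E]
    {U : Set E} (hU : IsOpen U) {x : E} (hx : x ∉ U) :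
    ∃ y ∉ U, ‖y‖ ≤ ‖x‖ ∧ ball 0 ‖y‖ ⊆ U := by
  obtain ⟨y, hy, hdist⟩ := hU.isClosed_compl.exists_infDist_eq_dist ⟨x, hx⟩ 0
  rw [dist_zero_left] at hdist
  refine ⟨y, hy, ?_, ?_⟩
  · simpa [hdist] using infDist_le_dist_of_mem (x := 0) (show x ∈ Uᶜ from hx)
  · exact disjoint_compl_right_iff_subset.1 (hdist ▸ disjoint_ball_infDist)

theorem isStronglyStarlike_of_mapsTo_openSector {α : ℝ} (hα : α ∈ Icc 0 2) {F : ℂ → ℂ}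
    (hF : DifferentiableOn ℂ F (ball 0 1)) (h0 : F 0 = 1) (hne : ∀ z ∈ ball 0 1, F z ≠ 0)
    (hmaps : MapsTo (starQuotient F) (ball 0 1) (openSector (Real.pi * α / 2))) :
    IsStronglyStarlike α (fun z => z * F z) := by
  have hβ : Real.pi * α / 2 ∈ Icc 0 Real.pi :=
    ⟨by have := hα.1; positivity, by nlinarith [hα.2, Real.pi_pos]⟩
  have hFat {z : ℂ} (hz : z ∈ ball 0 1) : DifferentiableAt ℂ F z :=
    hF.differentiableAt (isOpen_ball.mem_nhds hz)
  have hquot {z : ℂ} (hz : z ∈ ball 0 1) (hz0 : z ≠ 0) :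
      z * deriv (fun z => z * F z) z / (z * F z) = starQuotient F z := by
    rw [← mul_logDeriv_id_mul hz0 (hFat hz) (hne z hz), logDeriv_apply, mul_div_assoc]
  have hquot0 {z : ℂ} (hz : z ∈ ball 0 1) : starQuotient F z ≠ 0 :=
    ne_zero_of_mem_openSector (hmaps hz)
  refine ⟨differentiableOn_id.mul hF, zero_mul _, ?_, fun z hz hz0 => mul_ne_zero hz0 (hne z hz),
    fun z hz hz0 hderiv => ?_, fun z hz hz0 => ?_⟩
  · have := (hasDerivAt_id 0).fun_mul (hFat (mem_ball_self one_pos)).hasDerivAt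
    simpa [h0] using this.deriv
  · apply hquot0 hz
    rw [← hquot hz hz0, hderiv, mul_zero, zero_div]
  · rw [hquot hz hz0]
    exact (mem_openSector_iff_abs_arg_lt hβ (hquot0 hz)).1 (hmaps hz)

theorem isStronglyStarlike_of_not_isSectorExit {α : ℝ} (hα : α ∈ Ioo 0 1) {F : ℂ → ℂ}
    (hF : DifferentiableOn ℂ F (ball 0 1)) (h0 : F 0 = 1)
    (hexit : ∀ z ∈ ball 0 1, F z ≠ 0 →
      ¬ IsSectorExit α (starQuotient F z) (z * deriv (starQuotient F) z)) :
    IsStronglyStarlike α (fun z => z * F z) := by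
  have hβ : Real.pi * α / 2 ∈ Ioc 0 (Real.pi / 2) :=
    ⟨by have := hα.1; positivity, by nlinarith [hα.2, Real.pi_pos]⟩
  have hβπ : Real.pi * α / 2 ∈ Ioc 0 Real.pi := Ioc_subset_Ioc_right (by linarith [Real.pi_pos]) hβ
  have hquot {z : ℂ} (hz : z ∈ ball 0 1) (hne : F z ≠ 0) :
      DifferentiableAt ℂ (starQuotient F) z :=
    (hasDerivAt_starQuotient (hF.analyticAt (isOpen_ball.mem_nhds hz)) hne).differentiableAt
  set U : Set ℂ := {z | z ∈ ball 0 1 ∧ F z ≠ 0 ∧ starQuotient F z ∈ openSector (Real.pi * α / 2)}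
  have hU : IsOpen U :=
    isOpen_setOf_starQuotient_mem isOpen_ball (hF.analyticOnNhd isOpen_ball) (isOpen_openSector _)
  suffices hsub : ball 0 1 ⊆ U from
    isStronglyStarlike_of_mapsTo_openSector ⟨hα.1.le, by linarith [hα.2]⟩ hF h0
      (fun z hz => (hsub hz).2.1) fun z hz => (hsub hz).2.2
  have hq0 : starQuotient F 0 = 1 := by simp [starQuotient]
  intro z hz
  by_contra hzU
  obtain ⟨z₀, hz₀U, hz₀z, hball⟩ := exists_notMem_ball_norm_subset hU hzU
  have hz₀ : z₀ ∈ ball 0 1 := mem_ball_zero_iff.2 (hz₀z.trans_lt (mem_ball_zero_iff.1 hz))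
  have hz₀0 : z₀ ≠ 0 := fun h => hz₀U <| by
    rw [h]
    exact ⟨mem_ball_self one_pos, h0 ▸ one_ne_zero, hq0 ▸ one_mem_openSector hβπ⟩
  have hne₀ : F z₀ ≠ 0 := ne_zero_of_re_starQuotient_nonneg hz₀0
    (hF.mono (hball.trans fun y hy => hy.1)) (hF.continuousOn.continuousAt
      (isOpen_ball.mem_nhds hz₀)) (fun y hy => (hball hy).2.1)
    fun y hy => re_nonneg_of_mem_openSector (Ioc_subset_Icc_self hβ) (hball hy).2.2
  exact hexit z₀ hz₀ hne₀ <| isSectorExit_of_notMem_openSector hα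
    (fun y hy => (hquot (hball hy).1 (hball hy).2.1).differentiableWithinAt) (hquot hz₀ hne₀) hq0
    (fun y hy => (hball hy).2.2) fun h => hz₀U ⟨hz₀, hne₀, h⟩

/-! ### The Riccati equation on the boundary of the sector -/

theorem eq_zero_of_eq_mul_of_norm_le {𝕜 : Type*} [NormedField 𝕜] {x y z : 𝕜} (h : x = z * y)
    (hz : ‖z‖ < 1) (hle : ‖y‖ ≤ ‖x‖) : y = 0 := by
  by_contra hy
  rw [h, norm_mul] at hle
  exact hle.not_gt (mul_lt_of_lt_one_left (norm_pos_iff.2 hy) hz)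

theorem norm_add_le_norm_add_iff {E : Type*} [NormedAddCommGroup E] [InnerProductSpace ℝ E]
    {d x y : E} :
    ‖d + y‖ ≤ ‖d + x‖ ↔ ‖y‖ ^ 2 - ‖x‖ ^ 2 + 2 * inner ℝ d (y - x) ≤ 0 := by
  rw [← sq_le_sq₀ (norm_nonneg _) (norm_nonneg _), norm_add_sq_real, norm_add_sq_real,
    inner_sub_right]
  constructor <;> intro h <;> linarith

theorem inner_ofReal_mul_I_mul (r p : ℝ) (q u : ℂ) :
    inner ℝ (r * Complex.I * q) (p * q + u) = -(r * (u * (Complex.I * starRingEnd ℂ q)).re) := by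
  simp only [Complex.inner, map_mul, Complex.conj_ofReal, Complex.conj_I, Complex.mul_re,
    Complex.mul_im, Complex.add_re, Complex.add_im, Complex.neg_re, Complex.neg_im,
    Complex.conj_re, Complex.conj_im, Complex.ofReal_re, Complex.ofReal_im, Complex.I_re,
    Complex.I_im]
  ring

theorem re_mul_exp_mul_I_pos {u : ℂ} (hu : u ≠ 0) {θ : ℝ} (h : |u.arg| + |θ| < Real.pi / 2) :
    0 < (u * Complex.exp (θ * Complex.I)).re := by
  have hre : (u * Complex.exp (θ * Complex.I)).re = ‖u‖ * Real.cos (u.arg + θ) := by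
    conv_lhs => rw [← Complex.norm_mul_exp_arg_mul_I u]
    rw [mul_assoc, ← Complex.exp_add, ← add_mul, ← Complex.ofReal_add, Complex.re_ofReal_mul,
      Complex.exp_ofReal_mul_I_re]
  rw [hre]
  exact mul_pos (norm_pos_iff.2 hu)
    (Real.cos_pos_of_mem_Ioo (abs_lt.1 ((abs_add_le _ _).trans_lt h)))

theorem norm_mul_sub_one_add_sq {v : ℂ} (hv : ‖v‖ = 1) (x : ℝ) (u : ℂ) :
    ‖x * v - 1 + u‖ ^ 2 =
      x ^ 2 + 2 * x * ((u * starRingEnd ℂ v).re - v.re) + (‖u‖ ^ 2 - 2 * u.re + 1) := by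
  have hv' : v.re * v.re + v.im * v.im = 1 := by
    rw [← Complex.normSq_apply, Complex.normSq_eq_norm_sq, hv, one_pow]
  simp only [Complex.sq_norm, Complex.normSq_apply, Complex.add_re, Complex.add_im,
    Complex.sub_re, Complex.sub_im, Complex.mul_re, Complex.mul_im, Complex.conj_re,
    Complex.conj_im, Complex.ofReal_re, Complex.ofReal_im, Complex.one_re, Complex.one_im]
  linear_combination x ^ 2 * hv'

section SectorRay

variable {α ε : ℝ}

theorem norm_sectorRay (α ε : ℝ) : ‖sectorRay α ε‖ = 1 :=
  Complex.norm_exp_ofReal_mul_I _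

theorem re_sectorRay (α : ℝ) (hε : ε = 1 ∨ ε = -1) :
    (sectorRay α ε).re = Real.cos (Real.pi * α / 2) := by
  rw [sectorRay, Complex.exp_ofReal_mul_I_re]
  rcases hε with rfl | rfl <;> simp

theorem conj_sectorRay (α ε : ℝ) :
    starRingEnd ℂ (sectorRay α ε) = Complex.exp (-(ε * Complex.I * Real.pi * α / 2)) := by
  rw [sectorRay, ← Complex.exp_conj]
  congr 1
  simp only [map_mul, Complex.conj_ofReal, Complex.conj_I]
  push_cast
  ring

theorem rotatedRe_eq_re_mul_conj_sectorRay (α ε : ℝ) (u : ℂ) :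
    rotatedRe α ε u = (u * starRingEnd ℂ (sectorRay α ε)).re := by
  rw [conj_sectorRay, rotatedRe]

theorem exp_complement_eq_mul_conj_sectorRay (α : ℝ) (hε : ε = 1 ∨ ε = -1) :
    Complex.exp (ε * Real.pi * Complex.I * (1 - α) / 2) =
      ε * (Complex.I * starRingEnd ℂ (sectorRay α ε)) := by
  have hquarter : Complex.exp (ε * (Real.pi / 2 * Complex.I)) = ε * Complex.I := by
    rcases hε with rfl | rfl <;> simp [Complex.exp_neg]
  have hsum : (ε * Real.pi * Complex.I * (1 - α) / 2 : ℂ) =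
      ε * (Real.pi / 2 * Complex.I) + -(ε * Complex.I * Real.pi * α / 2) := by
    ring
  rw [hsum, Complex.exp_add, hquarter, conj_sectorRay, mul_assoc]

theorem re_mul_exp_complement_pos (hα : α ≤ 1) (hε : ε = 1 ∨ ε = -1) {u : ℂ} (hu : u ≠ 0)
    (harg : |u.arg| < Real.pi * α / 2) :
    0 < (u * Complex.exp (ε * Real.pi * Complex.I * (1 - α) / 2)).re := by
  have hangle : |ε * (Real.pi * (1 - α) / 2)| = Real.pi * (1 - α) / 2 := by
    have : 0 ≤ Real.pi * (1 - α) / 2 := by have := sub_nonneg.2 hα; positivity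
    rcases hε with rfl | rfl <;> simp [abs_of_nonneg this]
  have hexp : (ε * Real.pi * Complex.I * (1 - α) / 2 : ℂ) =
      (ε * (Real.pi * (1 - α) / 2) : ℝ) * Complex.I := by
    push_cast
    ring
  rw [hexp]
  exact re_mul_exp_mul_I_pos hu (by rw [hangle]; linarith)

theorem norm_sq_sub_norm_sq_eq_cubicG (hε : ε = 1 ∨ ε = -1) (α x : ℝ) {p : ℝ} {a b c : ℂ}
    (hp : (p : ℂ) = a + b + 1 - c) :
    ‖(x * sectorRay α ε - 1 + a) * (x * sectorRay α ε - 1 + b)‖ ^ 2 -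
        ‖(x * sectorRay α ε - 1) * (x * sectorRay α ε - 1 + (c - 1))‖ ^ 2 =
      cubicG α p ε a b c x := by
  have hnorm := norm_mul_sub_one_add_sq (norm_sectorRay α ε) x
  simp only [← rotatedRe_eq_re_mul_conj_sectorRay, re_sectorRay α hε] at hnorm
  have hnorm0 : ‖x * sectorRay α ε - 1‖ ^ 2 =
      x ^ 2 - 2 * x * Real.cos (Real.pi * α / 2) + 1 := by
    simpa [rotatedRe, ← sub_eq_add_neg] using hnorm 0
  have hc : c - 1 = a + b - p := by rw [hp]; ring
  have hre : (c - 1).re = a.re + b.re - p := by simp [hc]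
  have hrot : rotatedRe α ε (c - 1) =
      rotatedRe α ε a + rotatedRe α ε b - p * Real.cos (Real.pi * α / 2) := by
    rw [hc, ← re_sectorRay α hε]
    simp [rotatedRe_eq_re_mul_conj_sectorRay, add_mul, sub_mul]
  rw [norm_mul, norm_mul, mul_pow, mul_pow, hnorm0, hnorm, hnorm, hnorm, hrot, hre, cubicG, coeffS,
    coeffT, coeffU, coeffV]
  ring

theorem inner_mul_sectorRay (hε : ε = 1 ∨ ε = -1) (α r p x : ℝ) (u : ℂ) :
    inner ℝ ((ε * r : ℝ) * Complex.I * (x * sectorRay α ε)) (p * (x * sectorRay α ε) + u) =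
      -(r * x * (u * Complex.exp (ε * Real.pi * Complex.I * (1 - α) / 2)).re) := by
  rw [inner_ofReal_mul_I_mul, exp_complement_eq_mul_conj_sectorRay α hε, map_mul,
    Complex.conj_ofReal, ← Complex.re_ofReal_mul, ← Complex.re_ofReal_mul]
  congr 2
  push_cast
  ring

theorem not_isSectorExit_of_riccati (hα : α ∈ Ioc 0 1) {a b c : ℂ} {p : ℝ}
    (hp : (p : ℂ) = a + b + 1 - c) (hne : a * b - p ≠ 0)
    (harg : |(a * b - p).arg| < Real.pi * α / 2)
    (hG : ∀ s : ℝ, 0 < s → ∀ ε : ℝ, ε = 1 ∨ ε = -1 →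
      cubicG α p ε a b c (s ^ α) ≤ α * (s + s⁻¹) * s ^ α *
        ((a * b - p) * Complex.exp (ε * Real.pi * Complex.I * (1 - α) / 2)).re)
    {w d z : ℂ} (hz : ‖z‖ < 1)
    (hriccati : d + (w - 1) * (w - 1 + (c - 1)) = z * (d + (w - 1 + a) * (w - 1 + b))) :
    ¬ IsSectorExit α w d := by
  rintro ⟨ε, s, k, hε, hs, hk, hw, hd⟩
  have hR := re_mul_exp_complement_pos hα.2 hε hne harg
  have hGs := hG s hs ε hε
  have hα0 : 0 < α := hα.1
  have hk0 : 0 < k := lt_of_lt_of_le (by positivity) hk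
  have hdiff : (w - 1 + a) * (w - 1 + b) - (w - 1) * (w - 1 + (c - 1)) = p * w + (a * b - p) := by
    rw [hp]
    ring
  have hinner : inner ℝ d (p * w + (a * b - p)) = -(α * k * s ^ α *
      ((a * b - p) * Complex.exp (ε * Real.pi * Complex.I * (1 - α) / 2)).re) := by
    rw [hd, hw, mul_assoc ε α k, inner_mul_sectorRay hε]
  have hcubic := norm_sq_sub_norm_sq_eq_cubicG hε α (s ^ α) hp
  rw [← hw] at hcubic
  set R := ((a * b - p) * Complex.exp (ε * Real.pi * Complex.I * (1 - α) / 2)).re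
  have hle : ‖d + (w - 1 + a) * (w - 1 + b)‖ ≤ ‖d + (w - 1) * (w - 1 + (c - 1))‖ := by
    rw [norm_add_le_norm_add_iff, hdiff, hinner, hcubic]
    have : α * (s + s⁻¹) * s ^ α * R ≤ α * (2 * k) * s ^ α * R := by
      gcongr
      linarith
    linarith
  have hY := eq_zero_of_eq_mul_of_norm_le hriccati hz hle
  have hX : d + (w - 1) * (w - 1 + (c - 1)) = 0 := by rw [hriccati, hY, mul_zero]
  rw [← hdiff, ← add_sub_add_left_eq_sub _ _ d, hY, hX, sub_zero, inner_zero_right] at hinner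
  exact (neg_lt_zero.2 (by positivity : 0 < α * k * s ^ α * R)).ne' hinner

end SectorRay

theorem starQuotient_ordinaryHypergeometric_riccati {𝕂 : Type*} [RCLike 𝕂] (a b : 𝕂) {c : 𝕂}
    (hc : ∀ n : ℕ, c ≠ -(n : 𝕂)) {z : 𝕂} (hz : ‖z‖ < 1)
    (hne : ordinaryHypergeometric a b c z ≠ 0) {q : 𝕂 → 𝕂}
    (hq : q = starQuotient (ordinaryHypergeometric a b c)) :
    z * deriv q z + (q z - 1) * (q z - 1 + (c - 1)) =
      z * (z * deriv q z + (q z - 1 + a) * (q z - 1 + b)) := by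
  have hanalytic : AnalyticAt 𝕂 (ordinaryHypergeometric a b c) z :=
    (hasFPowerSeriesOnBall_ordinaryHypergeometric a b c).analyticAt_of_mem
      (by simpa [← ofReal_norm] using hz)
  have hode := ordinaryHypergeometric_equation a b hc hz
  rw [hq, (hasDerivAt_starQuotient hanalytic hne).deriv, starQuotient, logDeriv_apply]
  field_simp
  linear_combination z * ordinaryHypergeometric a b c z * hode

theorem mainTheorem7 (α : ℝ) (hα0 : 0 < α) (hα1 : α < 1) (a b c : ℂ)
    (hab : a * b ≠ 0) (hc : ∀ n : ℕ, c ≠ -(n : ℂ))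
    (p : ℝ) (hp : (p : ℂ) = a + b + 1 - c)
    (hne : a * b - (p : ℂ) ≠ 0)
    (harg : |Complex.arg (a * b - (p : ℂ))| < Real.pi * α / 2)
    (hG : ∀ s : ℝ, 0 < s → ∀ ε : ℝ, ε = 1 ∨ ε = -1 →
      cubicG α p ε a b c (s ^ α) ≤
        α * (s + s⁻¹) * s ^ α *
          ((a * b - (p : ℂ)) * Complex.exp (ε * Real.pi * Complex.I * (1 - α) / 2)).re) :
    IsStronglyStarlike α (shiftedHypergeometric a b c) := by
  refine isStronglyStarlike_of_not_isSectorExit ⟨hα0, hα1⟩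
    (differentiableOn_ordinaryHypergeometric a b c) (ordinaryHypergeometric_zero a b c)
    fun z hz hF => ?_
  have hz : ‖z‖ < 1 := mem_ball_zero_iff.1 hz
  exact not_isSectorExit_of_riccati ⟨hα0, hα1.le⟩ hp hne harg hG hz
    (starQuotient_ordinaryHypergeometric_riccati a b hc hz hF rfl)
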